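/- Consider propositional linear logic without variables: formulae are generated by $0,\ 1,\ A\otimes B,\ A\oplus B,\ {?}A,\ \top,\ \bot,\ A\parr B,\ A\mathbin{\&}B,\ {!}A$, with linear negation $A^\bot$ given by De Morgan duality ($0/\top$, $1/\bot$, $\otimes/\parr$, $\oplus/\&$, ${?}/{!}$); sequents are finite lists of formulae, read one-sidedly. Let: - $\mathrm{LL}$ be the usual one-sided sequent calculus (axiom, cut, exchange, the rules for $1,\bot,\top,\otimes,\parr,\oplus,\&$, and weakening, contraction, dereliction and promotion); - $\mathrm{LLT}$ be the calculus obtained from $\mathrm{LL}$ by replacing the tensor rule with: from $\Gamma,{?}\Theta,A$ and $\Delta,{?}\Theta,B$ infer $\Gamma,\Delta,{?}\Theta,A\otimes B$; - $\mathrm{LLT}_n$ (also written LLTN) be the calculus with cut, exchange, the rules of $\mathrm{LLT}$ for $1,\bot,\top,\otimes,\parr,\oplus,\&$, no axiom rule, and, as only rules for the exponentials: from $\Gamma,\parr^n A$ infer $\Gamma,{?}A$ (for any $n\in\mathbb N$), and from the infinite family of premises $\Gamma,\otimes^n A$ (one for each $n\in\mathbb N$) infer $\Gamma,{!}A$. Here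 $\parr^0A=\bot$, $\parr^{n+1}A=(\parr^nA)\parr A$, $\otimes^0A=1$, $\otimes^{n+1}A=(\otimes^nA)\otimes A$. Proofs are trees all of whose branches are finite. A proof in LLTN is *bounded* if it is either cut-free, or a single final cut of a cut-free proof of a one-formula sequent $A$ against a cut-free proof of $A^\bot,\Gamma$, with conclusion $\Gamma$. **Proposition.** $\mathrm{LLT}$ is not a model of LLTN: it is not the case that every sequent provable in LLTN is provable in $\mathrm{LLT}$, and it is not even the case that every sequent with a bounded proof in LLTN is provable in $\mathrm{LLT}$. More precisely, for $X=\bot\otimes\bot$, the sequent $$\bot\oplus(X^\bot\parr{?}X^\bot),\ {!}X$$ has a bounded proof in LLTN, but is provable neither in $\mathrm{LL}$ nor in $\mathrm{LLT}$. -/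

import Mathlib

namespace LinearLogic

/-- Formulae of propositional linear logic, built from the constants only
(there are no propositional variables). -/
inductive Formula : Type
  | zero : Formula
  | one : Formula
  | tensor : Formula → Formula → Formula
  | plus : Formula → Formula → Formula
  | whyNot : Formula → Formula
  | top : Formula
  | bot : Formula
  | par : Formula → Formula → Formula
  | with : Formula → Formula → Formula
  | ofCourse : Formula → Formula

namespace Formula

/-- Linear negation, by De Morgan duality. -/
def dual : Formula → Formula
  | zero => top
  | one => bot
  | tensor A B => par A.dual B.dual
  | plus A B => .with A.dual B.dual
  | whyNot A => ofCourse A.dual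
  | top => zero
  | bot => one
  | par A B => tensor A.dual B.dual
  | .with A B => plus A.dual B.dual
  | ofCourse A => whyNot A.dual

/-- The `n`-fold tensor: `⊗⁰ A = 1` and `⊗ⁿ⁺¹ A = (⊗ⁿ A) ⊗ A`. -/
def tensorPow (A : Formula) : ℕ → Formula
  | 0 => one
  | n + 1 => tensor (tensorPow A n) A

/-- The `n`-fold par: `⅋⁰ A = ⊥` and `⅋ⁿ⁺¹ A = (⅋ⁿ A) ⅋ A`. -/
def parPow (A : Formula) : ℕ → Formula
  | 0 => bot
  | n + 1 => par (parPow A n) A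

end Formula

open Formula

/-- One-sided sequents are lists of formulae. -/
abbrev Sequent : Type := List Formula

/-- `?Θ`: the list of the formulae `?A`, for `A` in `Θ`. -/
abbrev whyNots (Θ : List Formula) : Sequent := Θ.map whyNot

/-- Provability in (full) linear logic LL, with cut. -/
inductive LL : Sequent → Prop
  | ax (A : Formula) : LL [A, A.dual]
  | cut (Γ Δ : Sequent) (A : Formula) : LL (Γ ++ [A]) → LL (Δ ++ [A.dual]) → LL (Γ ++ Δ)
  | exchange (Γ Δ : Sequent) (A B : Formula) : LL (Γ ++ [B, A] ++ Δ) → LL (Γ ++ [A, B] ++ Δ)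
  | one : LL [one]
  | bot (Γ : Sequent) : LL Γ → LL (Γ ++ [bot])
  | top (Γ : Sequent) : LL (Γ ++ [top])
  | tensor (Γ Δ : Sequent) (A B : Formula) :
      LL (Γ ++ [A]) → LL (Δ ++ [B]) → LL (Γ ++ Δ ++ [tensor A B])
  | par (Γ : Sequent) (A B : Formula) : LL (Γ ++ [A, B]) → LL (Γ ++ [par A B])
  | plusLeft (Γ : Sequent) (A B : Formula) : LL (Γ ++ [A]) → LL (Γ ++ [plus A B])
  | plusRight (Γ : Sequent) (A B : Formula) : LL (Γ ++ [B]) → LL (Γ ++ [plus A B])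
  | with (Γ : Sequent) (A B : Formula) :
      LL (Γ ++ [A]) → LL (Γ ++ [B]) → LL (Γ ++ [.with A B])
  | weakening (Γ : Sequent) (A : Formula) : LL Γ → LL (Γ ++ [whyNot A])
  | contraction (Γ : Sequent) (A : Formula) :
      LL (Γ ++ [whyNot A, whyNot A]) → LL (Γ ++ [whyNot A])
  | dereliction (Γ : Sequent) (A : Formula) : LL (Γ ++ [A]) → LL (Γ ++ [whyNot A])
  | promotion (Γ : List Formula) (A : Formula) :
      LL (whyNots Γ ++ [A]) → LL (whyNots Γ ++ [ofCourse A])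

/-- Provability in LLT: the rules of LL, except that the tensor rule is replaced by the variant
in which the two premises share a list `?Θ` of why-not formulae. -/
inductive LLT : Sequent → Prop
  | ax (A : Formula) : LLT [A, A.dual]
  | cut (Γ Δ : Sequent) (A : Formula) : LLT (Γ ++ [A]) → LLT (Δ ++ [A.dual]) → LLT (Γ ++ Δ)
  | exchange (Γ Δ : Sequent) (A B : Formula) : LLT (Γ ++ [B, A] ++ Δ) → LLT (Γ ++ [A, B] ++ Δ)
  | one : LLT [one]
  | bot (Γ : Sequent) : LLT Γ → LLT (Γ ++ [bot])
  | top (Γ : Sequent) : LLT (Γ ++ [top])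
  | tensor (Γ Δ : Sequent) (Θ : List Formula) (A B : Formula) :
      LLT (Γ ++ whyNots Θ ++ [A]) → LLT (Δ ++ whyNots Θ ++ [B]) →
        LLT (Γ ++ Δ ++ whyNots Θ ++ [tensor A B])
  | par (Γ : Sequent) (A B : Formula) : LLT (Γ ++ [A, B]) → LLT (Γ ++ [par A B])
  | plusLeft (Γ : Sequent) (A B : Formula) : LLT (Γ ++ [A]) → LLT (Γ ++ [plus A B])
  | plusRight (Γ : Sequent) (A B : Formula) : LLT (Γ ++ [B]) → LLT (Γ ++ [plus A B])
  | with (Γ : Sequent) (A B : Formula) :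
      LLT (Γ ++ [A]) → LLT (Γ ++ [B]) → LLT (Γ ++ [.with A B])
  | weakening (Γ : Sequent) (A : Formula) : LLT Γ → LLT (Γ ++ [whyNot A])
  | contraction (Γ : Sequent) (A : Formula) :
      LLT (Γ ++ [whyNot A, whyNot A]) → LLT (Γ ++ [whyNot A])
  | dereliction (Γ : Sequent) (A : Formula) : LLT (Γ ++ [A]) → LLT (Γ ++ [whyNot A])
  | promotion (Γ : List Formula) (A : Formula) :
      LLT (whyNots Γ ++ [A]) → LLT (whyNots Γ ++ [ofCourse A])

namespace LLTN

/-- Proofs in LLTN: well-founded trees of inference rules. The rule for `!A` has one premise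
for each `n : ℕ`. -/
inductive Proof : Sequent → Type
  | cut (Γ Δ : Sequent) (A : Formula) :
      Proof (Γ ++ [A]) → Proof (Δ ++ [A.dual]) → Proof (Γ ++ Δ)
  | exchange (Γ Δ : Sequent) (A B : Formula) :
      Proof (Γ ++ [B, A] ++ Δ) → Proof (Γ ++ [A, B] ++ Δ)
  | one : Proof [one]
  | bot (Γ : Sequent) : Proof Γ → Proof (Γ ++ [bot])
  | top (Γ : Sequent) : Proof (Γ ++ [top])
  | tensor (Γ Δ : Sequent) (Θ : List Formula) (A B : Formula) :
      Proof (Γ ++ whyNots Θ ++ [A]) → Proof (Δ ++ whyNots Θ ++ [B]) →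
        Proof (Γ ++ Δ ++ whyNots Θ ++ [tensor A B])
  | par (Γ : Sequent) (A B : Formula) : Proof (Γ ++ [A, B]) → Proof (Γ ++ [par A B])
  | plusLeft (Γ : Sequent) (A B : Formula) : Proof (Γ ++ [A]) → Proof (Γ ++ [plus A B])
  | plusRight (Γ : Sequent) (A B : Formula) : Proof (Γ ++ [B]) → Proof (Γ ++ [plus A B])
  | with (Γ : Sequent) (A B : Formula) :
      Proof (Γ ++ [A]) → Proof (Γ ++ [B]) → Proof (Γ ++ [.with A B])
  | whyNot (Γ : Sequent) (A : Formula) (n : ℕ) :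
      Proof (Γ ++ [A.parPow n]) → Proof (Γ ++ [whyNot A])
  | ofCourse (Γ : Sequent) (A : Formula) :
      (∀ n : ℕ, Proof (Γ ++ [A.tensorPow n])) → Proof (Γ ++ [ofCourse A])

/-- A proof is cut-free when the cut rule is used nowhere in it. -/
def Proof.CutFree : {Γ : Sequent} → Proof Γ → Prop
  | _, .cut _ _ _ _ _ => False
  | _, .exchange _ _ _ _ π => π.CutFree
  | _, .one => True
  | _, .bot _ π => π.CutFree
  | _, .top _ => True
  | _, .tensor _ _ _ _ _ π ρ => π.CutFree ∧ ρ.CutFree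
  | _, .par _ _ _ π => π.CutFree
  | _, .plusLeft _ _ _ π => π.CutFree
  | _, .plusRight _ _ _ π => π.CutFree
  | _, .with _ _ _ π ρ => π.CutFree ∧ ρ.CutFree
  | _, .whyNot _ _ _ π => π.CutFree
  | _, .ofCourse _ _ π => ∀ n : ℕ, (π n).CutFree

/-- A proof is bounded when it is cut-free, or consists of a single final cut between a cut-free
proof of the one-formula sequent `A` and a cut-free proof of `Γ, A^⊥`. -/
inductive Proof.Bounded : {Γ : Sequent} → Proof Γ → Prop
  | cutFree {Γ : Sequent} (π : Proof Γ) : π.CutFree → Bounded π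
  | cut (Γ : Sequent) (A : Formula) (π₁ : Proof [A]) (π₂ : Proof (Γ ++ [A.dual])) :
      π₁.CutFree → π₂.CutFree → Bounded (Proof.cut [] Γ A π₁ π₂)

/-- Provability in LLTN. -/
def Provable (Γ : Sequent) : Prop := Nonempty (Proof Γ)

/-- Having a bounded proof in LLTN. -/
def BoundedProvable (Γ : Sequent) : Prop := ∃ π : Proof Γ, π.Bounded

end LLTN

/-- The validity notion `V` is a model of the provability notion `P` when every `P`-provable
sequent is `V`-valid. -/
def IsModelOf (V P : Sequent → Prop) : Prop := ∀ Γ : Sequent, P Γ → V Γ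

/-- The formula `X = ⊥ ⊗ ⊥`. -/
def botTensorBot : Formula := tensor bot bot

/-- The sequent `⊥ ⊕ (X^⊥ ⅋ ?X^⊥), !X`. -/
def laurentSequent (X : Formula) : Sequent :=
  [plus bot (par X.dual (whyNot X.dual)), ofCourse X]

end LinearLogic

/-! The sequent says `1 & (X ⊗ !X) ⊢ !X`. In LLTN the rule for `!X` has one premise per `n`, so the
additive choice may depend on `n`: the branch `1` proves `⊗⁰ X`, and the branch `X ⊗ !X` proves
`⊗ⁿ⁺¹ X`, with `!X` used at multiplicity `n`. No cut is needed (`CutFreeProvable.laurentSequent`).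
In LLT promotion is the uniform way to introduce `!X`, and it requires a context of why-not
formulae. Unprovability is shown semantically: LLT is sound for phase spaces with a submonoid for
the exponentials (`valid_of_llt`), and `gradedPhaseSpace` contains a point of `1 & (X ⊗ !X)` outside
`!X`. LL embeds in LLT by taking an empty shared context. -/

namespace LinearLogic

open Formula

open scoped Pointwise

/-! ### A cut-free proof in LLTN -/

namespace LLTN

/-- Having a cut-free proof in LLTN. -/
def CutFreeProvable (Γ : Sequent) : Prop := ∃ π : Proof Γ, π.CutFree

namespace CutFreeProvable

theorem bounded {Γ : Sequent} (h : CutFreeProvable Γ) : BoundedProvable Γ :=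
  let ⟨π, hπ⟩ := h
  ⟨π, .cutFree π hπ⟩

theorem one : CutFreeProvable [one] := ⟨.one, trivial⟩

theorem bot (Γ : Sequent) (h : CutFreeProvable Γ) : CutFreeProvable (Γ ++ [bot]) :=
  let ⟨π, hπ⟩ := h
  ⟨.bot Γ π, hπ⟩

theorem exchange (Γ Δ : Sequent) (A B : Formula) (h : CutFreeProvable (Γ ++ [B, A] ++ Δ)) :
    CutFreeProvable (Γ ++ [A, B] ++ Δ) :=
  let ⟨π, hπ⟩ := h
  ⟨.exchange Γ Δ A B π, hπ⟩

/-- The tensor rule without shared formulae. -/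
theorem tensor (Γ Δ : Sequent) (A B : Formula) (h₁ : CutFreeProvable (Γ ++ [A]))
    (h₂ : CutFreeProvable (Δ ++ [B])) : CutFreeProvable (Γ ++ Δ ++ [.tensor A B]) := by
  have key : CutFreeProvable (Γ ++ Δ ++ whyNots [] ++ [.tensor A B]) := by
    have h₁' : CutFreeProvable (Γ ++ whyNots [] ++ [A]) := by simpa using h₁
    have h₂' : CutFreeProvable (Δ ++ whyNots [] ++ [B]) := by simpa using h₂
    obtain ⟨π₁, hπ₁⟩ := h₁'
    obtain ⟨π₂, hπ₂⟩ := h₂'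
    exact ⟨.tensor Γ Δ [] A B π₁ π₂, hπ₁, hπ₂⟩
  simpa using key

theorem par (Γ : Sequent) (A B : Formula) (h : CutFreeProvable (Γ ++ [A, B])) :
    CutFreeProvable (Γ ++ [.par A B]) :=
  let ⟨π, hπ⟩ := h
  ⟨.par Γ A B π, hπ⟩

theorem plusLeft (Γ : Sequent) (A B : Formula) (h : CutFreeProvable (Γ ++ [A])) :
    CutFreeProvable (Γ ++ [plus A B]) :=
  let ⟨π, hπ⟩ := h
  ⟨.plusLeft Γ A B π, hπ⟩

theorem plusRight (Γ : Sequent) (A B : Formula) (h : CutFreeProvable (Γ ++ [B])) :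
    CutFreeProvable (Γ ++ [plus A B]) :=
  let ⟨π, hπ⟩ := h
  ⟨.plusRight Γ A B π, hπ⟩

theorem whyNot (Γ : Sequent) (A : Formula) (n : ℕ) (h : CutFreeProvable (Γ ++ [A.parPow n])) :
    CutFreeProvable (Γ ++ [whyNot A]) :=
  let ⟨π, hπ⟩ := h
  ⟨.whyNot Γ A n π, hπ⟩

theorem ofCourse (Γ : Sequent) (A : Formula)
    (h : ∀ n : ℕ, CutFreeProvable (Γ ++ [A.tensorPow n])) :
    CutFreeProvable (Γ ++ [ofCourse A]) := by
  choose π hπ using h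
  exact ⟨.ofCourse Γ A π, hπ⟩

theorem swap {A B : Formula} (h : CutFreeProvable [B, A]) : CutFreeProvable [A, B] :=
  exchange [] [] A B h

/-- LLTN has no axiom rule, so identities are built by expansion; this is the multiplicative step.
-/
theorem dual_tensor {A A' B B' : Formula} (hA : CutFreeProvable [A', A])
    (hB : CutFreeProvable [B', B]) : CutFreeProvable [.tensor A B, .par A' B'] := by
  have h : CutFreeProvable [A', B', .tensor A B] := tensor [A'] [B'] A B hA hB
  exact par [.tensor A B] A' B'
    (exchange [] [B'] (.tensor A B) A' (exchange [A'] [] (.tensor A B) B' h))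

theorem parPow_tensorPow {A A' : Formula} (h : CutFreeProvable [A', A]) :
    ∀ n : ℕ, CutFreeProvable [A'.parPow n, A.tensorPow n]
  | 0 => swap (bot [.one] one)
  | n + 1 => swap (dual_tensor (parPow_tensorPow h n) h)

theorem dual_botTensorBot : CutFreeProvable [botTensorBot.dual, botTensorBot] :=
  have h : CutFreeProvable [Formula.one, Formula.bot] := bot [.one] one
  swap (dual_tensor h h)

/-- Any formula `X` with a cut-free identity satisfies `1 & (X ⊗ !X) ⊢ !X` in LLTN. -/
theorem laurentSequent {X : Formula} (h : CutFreeProvable [X.dual, X]) :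
    CutFreeProvable (laurentSequent X) := by
  refine ofCourse [plus .bot (.par X.dual (.whyNot X.dual))] X fun n => swap ?_
  -- The side of `⊕` is chosen according to `n`, which a uniform promotion cannot do.
  cases n with
  | zero => exact plusLeft [.one] _ _ (bot [.one] one)
  | succ n =>
    refine plusRight [X.tensorPow (n + 1)] _ _ (par [X.tensorPow (n + 1)] _ _ ?_)
    -- Of the `n + 1` copies of `X`, one meets `X^⊥` and the other `n` meet `?X^⊥`.
    refine whyNot [X.tensorPow (n + 1), X.dual] X.dual n ?_
    have key : CutFreeProvable [X.dual.parPow n, X.dual, X.tensorPow (n + 1)] :=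
      tensor [X.dual.parPow n] [X.dual] _ _ (parPow_tensorPow h n) h
    exact exchange [X.tensorPow (n + 1)] [] _ _
      (exchange [] [X.dual] _ _ (exchange [X.dual.parPow n] [] _ _ key))

end CutFreeProvable

end LLTN

/-! ### Phase semantics -/

/-- Phase spaces, written additively, with a submonoid interpreting the exponentials. -/
structure PhaseSpace (M : Type*) [AddCommMonoid M] where
  /-- The interpretation of `⊥`. -/
  pole : Set M
  /-- The elements that may be discarded and duplicated. -/
  exps : AddSubmonoid M
  weaken : ∀ k ∈ exps, ∀ m ∈ pole, k + m ∈ pole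
  contract : ∀ k ∈ exps, ∀ m, k + k + m ∈ pole → k + m ∈ pole

namespace PhaseSpace

variable {M : Type*} [AddCommMonoid M] (S : PhaseSpace M)

/-- The orthogonal of a set. -/
def perp (s : Set M) : Set M := {m | ∀ x ∈ s, x + m ∈ S.pole}

theorem perp_anti {s t : Set M} (h : s ⊆ t) : S.perp t ⊆ S.perp s :=
  fun _ hm x hx => hm x (h hx)

theorem subset_perp_perp (s : Set M) : s ⊆ S.perp (S.perp s) := fun x hx m hm => by
  rw [add_comm]; exact hm x hx

theorem perp_perp_perp (s : Set M) : S.perp (S.perp (S.perp s)) = S.perp s :=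
  (S.perp_anti (S.subset_perp_perp s)).antisymm (S.subset_perp_perp _)

theorem perp_union (s t : Set M) : S.perp (s ∪ t) = S.perp s ∩ S.perp t := by
  ext m
  simp [perp, or_imp, forall_and]

theorem mem_perp_add {s t : Set M} {m : M} :
    m ∈ S.perp (s + t) ↔ ∀ x ∈ s, ∀ y ∈ t, x + y + m ∈ S.pole := by
  simp only [perp, Set.mem_ofPred_eq, Set.mem_add]
  exact ⟨fun h x hx y hy => h _ ⟨x, hx, y, hy, rfl⟩,
    fun h z ⟨x, hx, y, hy, e⟩ => e ▸ h x hx y hy⟩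

theorem add_subset_pole_iff {s t : Set M} : s + t ⊆ S.pole ↔ s ⊆ S.perp t := by
  rw [Set.add_subset_iff]
  exact forall₂_congr fun x _ => forall₂_congr fun y _ => by rw [add_comm]

theorem perp_zero : S.perp {0} = S.pole := by
  ext m
  simp [perp]

/-- The interpretation of formulae. -/
def interp : Formula → Set M
  | .zero => S.perp Set.univ
  | .one => S.perp S.pole
  | .tensor A B => S.perp (S.perp (interp A + interp B))
  | .plus A B => S.perp (S.perp (interp A ∪ interp B))
  | .whyNot A => S.perp (S.perp (interp A) ∩ S.exps)
  | .top => Set.univ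
  | .bot => S.pole
  | .par A B => S.perp (S.perp (interp A) + S.perp (interp B))
  | .with A B => interp A ∩ interp B
  | .ofCourse A => S.perp (S.perp (interp A ∩ S.exps))

/-- Every clause amounts to an orthogonal: `⊥` is that of `{0}`, and `&` that of the union of the
orthogonals. Hence a formula is determined by its refutations. -/
theorem perp_perp_interp (A : Formula) : S.perp (S.perp (S.interp A)) = S.interp A := by
  induction A with
  | top => exact Set.univ_subset_iff.mp (S.subset_perp_perp _)
  | bot => rw [interp, ← perp_zero, perp_perp_perp]
  | zero | one | tensor | plus | whyNot | par | ofCourse => exact S.perp_perp_perp _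
  | _ A B hA hB => rw [interp, ← hA, ← hB, ← perp_union, perp_perp_perp]

theorem interp_dual (A : Formula) : S.interp A.dual = S.perp (S.interp A) := by
  induction A with
  | zero => exact (S.perp_perp_interp .top).symm
  | one => rw [dual, interp, interp, ← perp_zero, perp_perp_perp]
  | plus A B hA hB => rw [dual, interp, interp, hA, hB, perp_perp_perp, perp_union]
  | tensor | whyNot | top | bot | par | ofCourse =>
    simp_all [dual, interp, perp_perp_perp, perp_perp_interp]
  | _ A B hA hB =>
    rw [dual, interp, interp, hA, hB, perp_union, perp_perp_interp, perp_perp_interp]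

/-- The set of the sums of refutations of the formulae of a sequent. -/
def refutations (Γ : Sequent) : Set M := (Γ.map fun A => S.perp (S.interp A)).sum

/-- Validity of a sequent. -/
def Valid (Γ : Sequent) : Prop := S.refutations Γ ⊆ S.pole

theorem refutations_append (Γ Δ : Sequent) :
    S.refutations (Γ ++ Δ) = S.refutations Γ + S.refutations Δ := by
  simp [refutations]

theorem refutations_singleton (A : Formula) : S.refutations [A] = S.perp (S.interp A) := by
  simp [refutations]

theorem refutations_pair (A B : Formula) :
    S.refutations [A, B] = S.perp (S.interp A) + S.perp (S.interp B) := by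
  simp [refutations]

theorem valid_append_singleton {Γ : Sequent} {A : Formula} :
    S.Valid (Γ ++ [A]) ↔ S.refutations Γ ⊆ S.interp A := by
  rw [Valid, refutations_append, refutations_singleton, add_subset_pole_iff, perp_perp_interp]

theorem perp_interp_whyNot (A : Formula) :
    S.perp (S.interp (.whyNot A)) = S.perp (S.perp (S.perp (S.interp A) ∩ S.exps)) := rfl

/-- The sums of those refutations of the formulae in `Θ` that lie in `exps`. -/
def expRefutations (Θ : List Formula) : Set M :=
  (Θ.map fun A => S.perp (S.interp A) ∩ (S.exps : Set M)).sum

theorem expRefutations_subset_exps (Θ : List Formula) : S.expRefutations Θ ⊆ S.exps := by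
  induction Θ with
  | nil => simp [expRefutations]
  | cons A Θ ih =>
    rw [expRefutations, List.map_cons, List.sum_cons, Set.add_subset_iff]
    exact fun x hx y hy => S.exps.add_mem hx.2 (ih hy)

/-- A sequent `Γ, ?Θ` only needs to be tested against the refutations of `Θ` in `exps`. -/
theorem add_refutations_whyNots_subset_pole {s : Set M} {Θ : List Formula} :
    s + S.refutations (whyNots Θ) ⊆ S.pole ↔ s + S.expRefutations Θ ⊆ S.pole := by
  induction Θ generalizing s with
  | nil => simp [refutations, expRefutations]
  | cons A Θ ih =>
    have e₁ : S.refutations (whyNots (A :: Θ)) =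
        S.perp (S.perp (S.perp (S.interp A) ∩ S.exps)) + S.refutations (whyNots Θ) := by
      simp [refutations, perp_interp_whyNot]
    have e₂ : S.expRefutations (A :: Θ) =
        (S.perp (S.interp A) ∩ S.exps) + S.expRefutations Θ := by
      simp [expRefutations]
    -- Whether a sum lies in the pole depends on each summand only through its biorthogonal.
    rw [e₁, e₂, ← add_assoc, ih, ← add_assoc, add_right_comm, add_subset_pole_iff,
      perp_perp_perp, ← add_subset_pole_iff, add_right_comm]

theorem valid_tensor {Γ Δ : Sequent} {Θ : List Formula} {A B : Formula}
    (hA : S.Valid (Γ ++ whyNots Θ ++ [A])) (hB : S.Valid (Δ ++ whyNots Θ ++ [B])) :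
    S.Valid (Γ ++ Δ ++ whyNots Θ ++ [.tensor A B]) := by
  have swap (Γ : Sequent) (C : Formula) : S.Valid (Γ ++ whyNots Θ ++ [C]) ↔
      S.refutations Γ + S.expRefutations Θ ⊆ S.interp C := by
    rw [Valid, refutations_append, refutations_append, refutations_singleton, add_right_comm,
      add_refutations_whyNots_subset_pole, add_right_comm, add_subset_pole_iff, perp_perp_interp]
  rw [swap, Set.add_subset_iff] at hA hB ⊢
  rw [refutations_append]
  rintro _ ⟨x, hx, y, hy, rfl⟩ k hk
  intro z hz
  -- The same `k` refutes the shared `?Θ` in both premises, so `k + k` appears and `contract`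
  -- reduces it to `k`.
  have hk' := S.expRefutations_subset_exps Θ hk
  have := hz _ (Set.add_mem_add (hA x hx k hk) (hB y hy k hk))
  have h := S.contract k hk' (x + y + z) (by convert this using 1; abel)
  change z + (x + y + k) ∈ S.pole
  rwa [show z + (x + y + k) = k + (x + y + z) by abel]

/-- Soundness of LLT. -/
theorem valid_of_llt {Γ : Sequent} (h : LLT Γ) : S.Valid Γ := by
  induction h with
  | ax A =>
    rw [Valid, refutations_pair, add_subset_pole_iff, interp_dual, perp_perp_perp]
  | cut Γ Δ A _ _ h₁ h₂ =>
    rw [valid_append_singleton] at h₁ h₂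
    rw [interp_dual] at h₂
    rw [Valid, refutations_append, add_comm, add_subset_pole_iff]
    exact h₂.trans (S.perp_anti h₁)
  | exchange Γ Δ A B _ h =>
    rw [Valid, refutations_append, refutations_append, refutations_pair] at h ⊢
    rwa [add_comm (S.perp (S.interp A))]
  | one =>
    rw [Valid, refutations_singleton, interp, ← perp_zero, perp_perp_perp]
  | bot Γ _ h => rwa [valid_append_singleton]
  | top Γ => rw [valid_append_singleton]; exact Set.subset_univ _
  | tensor Γ Δ Θ A B _ _ h₁ h₂ => exact S.valid_tensor h₁ h₂
  | par Γ A B _ h =>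
    rw [valid_append_singleton, interp, ← add_subset_pole_iff]
    rwa [Valid, refutations_append, refutations_pair] at h
  | plusLeft Γ A B _ h =>
    rw [valid_append_singleton] at h ⊢
    exact (h.trans Set.subset_union_left).trans (S.subset_perp_perp _)
  | plusRight Γ A B _ h =>
    rw [valid_append_singleton] at h ⊢
    exact (h.trans Set.subset_union_right).trans (S.subset_perp_perp _)
  | weakening Γ A _ h =>
    rw [valid_append_singleton]
    exact fun x hx k hk => S.weaken k hk.2 x (h hx)
  | contraction Γ A _ h =>
    have e : Γ ++ [Formula.whyNot A, .whyNot A] = Γ ++ whyNots [A, A] := rfl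
    rw [e, Valid, refutations_append, add_refutations_whyNots_subset_pole] at h
    rw [valid_append_singleton]
    intro x hx k hk
    refine S.contract k hk.2 x ?_
    have := h (Set.add_mem_add hx
      (show k + k ∈ S.expRefutations [A, A] by
        simpa [expRefutations] using Set.add_mem_add hk hk))
    rwa [add_comm]
  | dereliction Γ A _ h =>
    rw [valid_append_singleton] at h ⊢
    intro x hx k hk
    rw [add_comm]
    exact hk.1 x (h hx)
  | promotion Γ A _ h =>
    rw [Valid, refutations_append, add_comm, add_refutations_whyNots_subset_pole,
      refutations_singleton, add_comm, add_subset_pole_iff] at h ⊢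
    rw [perp_perp_interp] at h ⊢
    -- Refutations of the context taken in `exps` have their sum in `exps` as well as in `A`.
    exact (Set.subset_inter h (S.expRefutations_subset_exps Γ)).trans (S.subset_perp_perp _)
  | _ Γ A B _ _ h₁ h₂ =>
    rw [valid_append_singleton] at h₁ h₂ ⊢
    exact Set.subset_inter h₁ h₂

end PhaseSpace

theorem LL.llt {Γ : Sequent} (h : LL Γ) : LLT Γ := by
  induction h with
  | ax A => exact .ax A
  | cut Γ Δ A _ _ h₁ h₂ => exact .cut Γ Δ A h₁ h₂
  | exchange Γ Δ A B _ h => exact .exchange Γ Δ A B h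
  | one => exact .one
  | bot Γ _ h => exact .bot Γ h
  | top Γ => exact .top Γ
  | tensor Γ Δ A B _ _ h₁ h₂ =>
    have := LLT.tensor Γ Δ [] A B (by simpa using h₁) (by simpa using h₂)
    simpa using this
  | par Γ A B _ h => exact .par Γ A B h
  | plusLeft Γ A B _ h => exact .plusLeft Γ A B h
  | plusRight Γ A B _ h => exact .plusRight Γ A B h
  | weakening Γ A _ h => exact .weakening Γ A h
  | contraction Γ A _ h => exact .contraction Γ A h
  | dereliction Γ A _ h => exact .dereliction Γ A h
  | promotion Γ A _ h => exact .promotion Γ A h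
  | _ Γ A B _ _ h₁ h₂ => exact .with Γ A B h₁ h₂

/-! ### The countermodel -/

/-- A phase space on tuples `(d, b, p, i)`: `d` is a degree, and only the vanishing of `b`, `p`
and `i` matters. The multiples of the last generator interpret the exponentials. -/
def gradedPhaseSpace : PhaseSpace (ℤ × ℕ × ℕ × ℕ) where
  -- The point `(1, 0, 0, 0)` generates degrees. A nonzero `i` marks the exponentials in `X`; `p`
  -- marks the point of `1 & (X ⊗ !X)`; `b` marks a refutation of `!X` that is harmless only in the
  -- presence of `i`.
  pole := {m | (m.2.2.2 ≠ 0 ∧ m.1 % 2 = 1 ∧ m.1 ≤ 1) ∨ (m.1 = 1 ∧ m.2.1 = 0) ∨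
    (m.2.2.1 ≠ 0 ∧ m.1 % 2 = 1 ∧ m.1 ≤ -1)}
  exps :=
    { carrier := {m | m.1 = 0 ∧ m.2.1 = 0 ∧ m.2.2.1 = 0}
      zero_mem' := by simp
      add_mem' := by
        simp only [Set.mem_ofPred_eq, Prod.fst_add, Prod.snd_add]
        omega }
  weaken := by
    rintro k ⟨h₁, h₂, h₃⟩ m
    simp only [Set.mem_ofPred_eq, Prod.fst_add, Prod.snd_add]
    omega
  contract := by
    rintro k ⟨h₁, h₂, h₃⟩ m
    simp only [Set.mem_ofPred_eq, Prod.fst_add, Prod.snd_add]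
    omega

theorem mem_gradedPhaseSpace_pole {m : ℤ × ℕ × ℕ × ℕ} : m ∈ gradedPhaseSpace.pole ↔
    (m.2.2.2 ≠ 0 ∧ m.1 % 2 = 1 ∧ m.1 ≤ 1) ∨ (m.1 = 1 ∧ m.2.1 = 0) ∨
      (m.2.2.1 ≠ 0 ∧ m.1 % 2 = 1 ∧ m.1 ≤ -1) := Iff.rfl

theorem mem_gradedPhaseSpace_exps {m : ℤ × ℕ × ℕ × ℕ} : m ∈ gradedPhaseSpace.exps ↔
    m.1 = 0 ∧ m.2.1 = 0 ∧ m.2.2.1 = 0 := Iff.rfl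

theorem gradedPhaseSpace_interp_botTensorBot_mem {m : ℤ × ℕ × ℕ × ℕ}
    (hm : m ∈ gradedPhaseSpace.exps) :
    m ∈ gradedPhaseSpace.interp botTensorBot ↔ m.2.2.2 ≠ 0 := by
  rw [mem_gradedPhaseSpace_exps] at hm
  constructor
  · intro h
    -- Two elements of the pole have even total degree at most 2, so shifting by -1 lands in the
    -- pole; if `i = 0` and one degree is at most -1, the `p` clause applies. Added to `m`, the same
    -- shift gives degree -1 with `p = 0`, which forces `i ≠ 0`.
    have := h (-1, 0, 0, 0) (by
      rw [PhaseSpace.mem_perp_add]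
      intro x hx y hy
      simp only [PhaseSpace.interp, mem_gradedPhaseSpace_pole, Prod.fst_add, Prod.snd_add]
        at hx hy ⊢
      omega)
    simp only [mem_gradedPhaseSpace_pole, Prod.fst_add, Prod.snd_add] at this
    omega
  · intro h w hw
    rw [PhaseSpace.mem_perp_add] at hw
    have o : (1, 0, 0, 0) ∈ gradedPhaseSpace.pole := by simp [mem_gradedPhaseSpace_pole]
    have := hw _ o _ o
    simp only [mem_gradedPhaseSpace_pole, Prod.fst_add, Prod.snd_add] at this ⊢
    omega

theorem not_valid_laurentSequent :
    ¬ gradedPhaseSpace.Valid (laurentSequent botTensorBot) := by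
  intro h
  rw [PhaseSpace.Valid, laurentSequent, PhaseSpace.refutations_pair] at h
  have hP : ((0, 0, 1, 0) : ℤ × ℕ × ℕ × ℕ) ∈ gradedPhaseSpace.perp (gradedPhaseSpace.interp
      (plus .bot (.par botTensorBot.dual (.whyNot botTensorBot.dual)))) := by
    rw [PhaseSpace.interp, PhaseSpace.perp_perp_perp, PhaseSpace.perp_union]
    constructor
    · intro x hx
      simp only [PhaseSpace.interp, mem_gradedPhaseSpace_pole, Prod.fst_add, Prod.snd_add] at hx ⊢
      omega
    · intro w hw
      rw [PhaseSpace.interp, PhaseSpace.mem_perp_add, PhaseSpace.perp_interp_whyNot,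
        PhaseSpace.interp_dual, PhaseSpace.perp_perp_interp] at hw
      have o : (1, 0, 0, 0) ∈ gradedPhaseSpace.pole := by simp [mem_gradedPhaseSpace_pole]
      have e : (0, 0, 0, 1) ∈ gradedPhaseSpace.exps := by simp [mem_gradedPhaseSpace_exps]
      -- Testing `w` against `(2, 0, 0, 0)` in `X` and `(0, 0, 0, 1)` in `!X` forces its degree to
      -- be odd and at most -1, exactly what the `p` clause needs.
      have := hw _ (PhaseSpace.subset_perp_perp _ _ (Set.add_mem_add o o)) (0, 0, 0, 1)
        (PhaseSpace.subset_perp_perp _ _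
          ⟨(gradedPhaseSpace_interp_botTensorBot_mem e).2 one_ne_zero, e⟩)
      simp only [mem_gradedPhaseSpace_pole, Prod.fst_add, Prod.snd_add] at this ⊢
      omega
  have hj : ((1, 1, 0, 0) : ℤ × ℕ × ℕ × ℕ) ∈
      gradedPhaseSpace.perp (gradedPhaseSpace.interp (.ofCourse botTensorBot)) := by
    rw [PhaseSpace.interp, PhaseSpace.perp_perp_perp]
    rintro k ⟨hk, hk'⟩
    have hk₀ := (gradedPhaseSpace_interp_botTensorBot_mem hk').1 hk
    rw [SetLike.mem_coe, mem_gradedPhaseSpace_exps] at hk'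
    simp only [mem_gradedPhaseSpace_pole, Prod.fst_add, Prod.snd_add]
    omega
  have := h (Set.add_mem_add hP hj)
  -- The sum `(1, 1, 1, 0)` misses every clause: `i = 0`, `b ≠ 0`, and degree 1 exceeds -1.
  simp [mem_gradedPhaseSpace_pole] at this

theorem not_llt_laurentSequent : ¬ LLT (laurentSequent botTensorBot) :=
  fun h => not_valid_laurentSequent (gradedPhaseSpace.valid_of_llt h)

theorem LLTN.boundedProvable_laurentSequent :
    LLTN.BoundedProvable (laurentSequent botTensorBot) :=
  (LLTN.CutFreeProvable.laurentSequent LLTN.CutFreeProvable.dual_botTensorBot).bounded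

end LinearLogic

theorem mainTheorem9 :
    (¬ LinearLogic.IsModelOf LinearLogic.LLT LinearLogic.LLTN.Provable) ∧
    (¬ LinearLogic.IsModelOf LinearLogic.LLT LinearLogic.LLTN.BoundedProvable) ∧
    LinearLogic.LLTN.BoundedProvable
      (LinearLogic.laurentSequent LinearLogic.botTensorBot) ∧
    (¬ LinearLogic.LL (LinearLogic.laurentSequent LinearLogic.botTensorBot)) ∧
    (¬ LinearLogic.LLT (LinearLogic.laurentSequent LinearLogic.botTensorBot)) := by
  have hb := LinearLogic.LLTN.boundedProvable_laurentSequent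
  have hn := LinearLogic.not_llt_laurentSequent
  exact ⟨fun h => hn (h _ ⟨hb.choose⟩), fun h => hn (h _ hb), hb, fun h => hn h.llt, hn⟩
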